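/- Let $n\ge 1$, let $K=U(n)$ act on $\mathbb C^n$ in the usual way, and for $z=x+iy\in\mathbb C^n$ let $\pi(z)$ be the unitary operator on $L^2(\mathbb R^n)$ given by the Schrödinger representation of the Heisenberg group with parameter $\lambda=1$, \[(\pi(z)\varphi)(\xi)=e^{i(x\cdot\xi+\frac12 x\cdot y)}\varphi(\xi+y).\] Let $\mu$ be a (metaplectic) unitary representation of $K$ on $L^2(\mathbb R^n)$ satisfying $\pi(kz)=\mu(k)\pi(z)\mu(k)^*$ for all $k\in K$, $z\in\mathbb C^n$; such a $\mu$ exists. Let $(\sigma,\mathcal H_\sigma)$ be an irreducible (finite-dimensional, continuous) unitary representation of $K$, put $\rho_\sigma(z,k)=\pi(z)\mu(k)\otimes\sigma(k)$ on $\mathcal H_\sigma^2=L^2(\mathbb R^n)\otimes\mathcal H_\sigma$, and for $f_1,f_2\in\mathcal H_\sigma^2$ put \[V_{f_1}^{f_2}(z,k)=\langle\rho_\sigma(z,k)f_1,f_2\rangle,\qquad (z,k)\in\mathbb C^n\times K.\] **Proposition 3.4.** Let $f_1,f_2\in\mathcal H_\sigma^2$ and $F=V_{f_1}^{f_2}$.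 If there is a set $\Sigma\subset\mathbb C^n$ of finite Lebesgue measure such that $F(z,k)=0$ for all $z\in\mathbb C^n\smallsetminus\Sigma$ and all $k\in K$, then $F(z,k)=0$ for all $(z,k)\in\mathbb C^n\times K$. -/

import Mathlib

open MeasureTheory
open scoped TensorProduct

namespace HeisenbergMotion

noncomputable section

/-- The Hilbert space `L²(ℝⁿ)` of complex-valued functions. -/
abbrev L2 (n : ℕ) : Type :=
  Lp ℂ 2 (volume : Measure (EuclideanSpace ℝ (Fin n)))

/-- The real part `x` of `z = x + iy ∈ ℂⁿ`. -/
def rePart {n : ℕ} (z : Fin n → ℂ) : EuclideanSpace ℝ (Fin n) :=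
  WithLp.toLp 2 fun j => (z j).re

/-- The imaginary part `y` of `z = x + iy ∈ ℂⁿ`. -/
def imPart {n : ℕ} (z : Fin n → ℂ) : EuclideanSpace ℝ (Fin n) :=
  WithLp.toLp 2 fun j => (z j).im

/-- The unimodular factor `exp (i (x·ξ + x·y/2))`, where `z = x + iy`. -/
def phase {n : ℕ} (z : Fin n → ℂ) (ξ : EuclideanSpace ℝ (Fin n)) : ℂ :=
  Complex.exp
    (((inner ℝ (rePart z) ξ + 1 / 2 * inner ℝ (rePart z) (imPart z) : ℝ) : ℂ) * Complex.I)

theorem norm_phase {n : ℕ} (z : Fin n → ℂ) (ξ : EuclideanSpace ℝ (Fin n)) :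
    ‖phase z ξ‖ = 1 :=
  Complex.norm_exp_ofReal_mul_I _

theorem continuous_phase {n : ℕ} (z : Fin n → ℂ) : Continuous (phase z) := by
  unfold phase
  fun_prop

theorem translate_ae {n : ℕ} (y : EuclideanSpace ℝ (Fin n))
    {f g : EuclideanSpace ℝ (Fin n) → ℂ} (h : f =ᵐ[volume] g) :
    (fun ξ => f (ξ + y)) =ᵐ[volume] fun ξ => g (ξ + y) :=
  (measurePreserving_add_right volume y).quasiMeasurePreserving.ae_eq h

theorem memLp_schrodinger {n : ℕ} (z : Fin n → ℂ) (φ : L2 n) :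
    MemLp (fun ξ => phase z ξ * φ (ξ + imPart z)) 2 volume := by
  have h : MemLp (fun ξ => φ (ξ + imPart z)) 2 volume :=
    (Lp.memLp φ).comp_measurePreserving (measurePreserving_add_right volume (imPart z))
  refine h.of_le ((continuous_phase z).aestronglyMeasurable.mul h.1) ?_
  filter_upwards with ξ
  simp [norm_phase]

/-- The Schrödinger representation with parameter `λ = 1`, at the point `(z, 0)` of the
Heisenberg group, where `z = x + iy`:
`(π(z) φ)(ξ) = exp (i (x·ξ + x·y/2)) φ(ξ + y)`. -/
def schrodinger {n : ℕ} (z : Fin n → ℂ) : L2 n →ₗ[ℂ] L2 n where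
  toFun φ := (memLp_schrodinger z φ).toLp _
  map_add' φ ψ := by
    rw [← MemLp.toLp_add]
    apply MemLp.toLp_congr
    filter_upwards [translate_ae (imPart z) (Lp.coeFn_add φ ψ)] with ξ h
    simp only [Pi.add_apply] at h ⊢
    rw [h, mul_add]
  map_smul' c φ := by
    rw [RingHom.id_apply, ← MemLp.toLp_const_smul]
    apply MemLp.toLp_congr
    filter_upwards [translate_ae (imPart z) (Lp.coeFn_smul c φ)] with ξ h
    simp only [Pi.smul_apply, smul_eq_mul] at h ⊢
    rw [h]
    ring

theorem coeFn_schrodinger {n : ℕ} (z : Fin n → ℂ) (φ : L2 n) :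
    schrodinger z φ =ᵐ[volume] fun ξ => phase z ξ * φ (ξ + imPart z) :=
  MemLp.coeFn_toLp (memLp_schrodinger z φ)

theorem phase_mul {n : ℕ} (z w : Fin n → ℂ) (ξ : EuclideanSpace ℝ (Fin n)) :
    phase z ξ * phase w (ξ + imPart z) =
      Complex.exp (((1 / 2 * (inner ℝ (imPart z) (rePart w) -
        inner ℝ (rePart z) (imPart w)) : ℝ) : ℂ) * Complex.I) * phase (z + w) ξ := by
  have h1 : rePart (z + w) = rePart z + rePart w := by ext j; simp [rePart]
  have h2 : imPart (z + w) = imPart z + imPart w := by ext j; simp [imPart]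
  unfold phase
  rw [← Complex.exp_add, ← Complex.exp_add, h1, h2, ← add_mul, ← add_mul, ← Complex.ofReal_add,
    ← Complex.ofReal_add]
  simp only [inner_add_left, inner_add_right]
  rw [real_inner_comm (rePart w) (imPart z)]
  congr 3
  ring

/-- The multiplier of the projective representation `π`: `exp ((i/2) Im (z · w̄))`. -/
def cocycle {n : ℕ} (z w : Fin n → ℂ) : ℂ :=
  Complex.exp ((((1 / 2 * ∑ j, z j * star (w j)).im : ℝ) : ℂ) * Complex.I)

theorem cocycle_eq {n : ℕ} (z w : Fin n → ℂ) :
    (1 / 2 * ∑ j, z j * star (w j) : ℂ).im = 1 / 2 * (inner ℝ (imPart z) (rePart w) -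
        inner ℝ (rePart z) (imPart w)) := by
  simp [rePart, imPart, PiLp.inner_apply, ← Finset.sum_sub_distrib]
  apply Finset.sum_congr rfl
  intros
  ring

theorem schrodinger_comp {n : ℕ} (z w : Fin n → ℂ) (φ : L2 n) :
    schrodinger z (schrodinger w φ) = cocycle z w • schrodinger (z + w) φ := by
  apply Lp.ext
  have h2 : imPart (z + w) = imPart z + imPart w := by ext j; simp [imPart]
  filter_upwards [coeFn_schrodinger z (schrodinger w φ),
    translate_ae (imPart z) (coeFn_schrodinger w φ), coeFn_schrodinger (z + w) φ,
    Lp.coeFn_smul (cocycle z w) (schrodinger (z + w) φ)] with ξ a b c d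
  rw [a, b, d, Pi.smul_apply, c, smul_eq_mul, ← mul_assoc, ← mul_assoc, phase_mul, cocycle,
    cocycle_eq, h2, add_assoc]

theorem schrodinger_zero {n : ℕ} (φ : L2 n) : schrodinger (0 : Fin n → ℂ) φ = φ := by
  apply Lp.ext
  have h1 : rePart (0 : Fin n → ℂ) = 0 := by ext j; simp [rePart]
  have h2 : imPart (0 : Fin n → ℂ) = 0 := by ext j; simp [imPart]
  filter_upwards [coeFn_schrodinger 0 φ] with ξ a
  rw [a]
  simp [phase, h1, h2]

theorem norm_schrodinger {n : ℕ} (z : Fin n → ℂ) (φ : L2 n) : ‖schrodinger z φ‖ = ‖φ‖ := by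
  change ‖(memLp_schrodinger z φ).toLp _‖ = ‖φ‖
  rw [Lp.norm_toLp, Lp.norm_def]
  congr 1
  rw [← eLpNorm_comp_measurePreserving (Lp.aestronglyMeasurable φ)
    (measurePreserving_add_right volume (imPart z))]
  apply eLpNorm_congr_norm_ae
  filter_upwards with ξ
  simp [norm_phase]

theorem cocycle_neg_self {n : ℕ} (z : Fin n → ℂ) : cocycle (-z) z = 1 := by
  rw [cocycle, cocycle_eq]
  have h1 : rePart (-z) = -rePart z := by ext j; simp [rePart]
  have h2 : imPart (-z) = -imPart z := by ext j; simp [imPart]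
  rw [h1, h2, inner_neg_left, inner_neg_left, real_inner_comm]
  simp

theorem inner_schrodinger_left {n : ℕ} (z : Fin n → ℂ) (φ ψ : L2 n) :
    inner ℂ (schrodinger z φ) ψ = inner ℂ φ (schrodinger (-z) ψ) := by
  let T : L2 n →ₗᵢ[ℂ] L2 n := ⟨schrodinger (-z), norm_schrodinger (-z)⟩
  rw [← T.inner_map_map]
  change inner ℂ (schrodinger (-z) (schrodinger z φ)) (schrodinger (-z) ψ) = _
  rw [schrodinger_comp, cocycle_neg_self, one_smul, neg_add_cancel, schrodinger_zero]

theorem integrable_gauss (n : ℕ) : Integrable fun ξ : EuclideanSpace ℝ (Fin n) =>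
    Complex.exp (-1 * ‖ξ‖ ^ 2) := by
  simpa using GaussianFourier.integrable_cexp_neg_mul_sq_norm_add (b := 1) (by simp) 0
    (0 : EuclideanSpace ℝ (Fin n))

theorem memLp_gauss (n : ℕ) : MemLp (fun ξ : EuclideanSpace ℝ (Fin n) =>
    ((Real.exp (-‖ξ‖ ^ 2 / 2) : ℝ) : ℂ)) 2 volume := by
  rw [memLp_two_iff_integrable_sq_norm (by fun_prop)]
  refine (integrable_gauss n).norm.congr ?_
  filter_upwards with ξ
  rw [Complex.norm_exp, Complex.norm_real, Real.norm_of_nonneg (Real.exp_pos _).le,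
    ← Real.exp_nat_mul]
  congr 1
  simp [← Complex.ofReal_pow]
  ring

/-- The Gaussian `exp (-|ξ|²/2)`. -/
def gauss (n : ℕ) : L2 n := (memLp_gauss n).toLp _

theorem inner_gauss {n : ℕ} (z : Fin n → ℂ) :
    inner ℂ (gauss n) (schrodinger z (gauss n)) =
      (Real.pi : ℂ) ^ (n / 2 : ℂ) * Complex.exp (-(∑ j, z j * star (z j)) / 4) := by
  rw [L2.inner_def]
  have e1 : ∫ ξ, inner ℂ (gauss n ξ) (schrodinger z (gauss n) ξ) =
      ∫ ξ : EuclideanSpace ℝ (Fin n), Complex.exp (-‖imPart z‖ ^ 2 / 4) *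
        Complex.exp (-1 * ‖ξ + (1 / 2 : ℝ) • imPart z‖ ^ 2 +
          Complex.I * (inner ℝ (rePart z) (ξ + (1 / 2 : ℝ) • imPart z) : ℝ)) := by
    apply integral_congr_ae
    have hg : gauss n =ᵐ[volume] _ := (memLp_gauss n).coeFn_toLp
    filter_upwards [hg, translate_ae (imPart z) hg, coeFn_schrodinger z (gauss n)] with ξ a b c
    rw [c, a, b, RCLike.inner_apply, Complex.conj_ofReal, phase, Complex.ofReal_exp,
      Complex.ofReal_exp, ← Complex.exp_add, ← Complex.exp_add, ← Complex.exp_add]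
    congr 1
    rw [inner_add_right, inner_smul_right, ← Complex.ofReal_pow, ← Complex.ofReal_pow,
      norm_add_sq_real, norm_add_sq_real, norm_smul, inner_smul_right]
    simp only [Complex.ofReal_add, Complex.ofReal_mul, Complex.ofReal_neg, Complex.ofReal_div,
      Complex.ofReal_pow, Complex.ofReal_one, Complex.ofReal_ofNat, mul_pow]
    norm_num
    ring
  rw [e1, integral_const_mul, integral_add_right_eq_self (fun ξ : EuclideanSpace ℝ (Fin n) =>
    Complex.exp (-1 * ‖ξ‖ ^ 2 + Complex.I * (inner ℝ (rePart z) ξ : ℝ))),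
    GaussianFourier.integral_cexp_neg_mul_sq_norm_add (by simp)]
  have e2 : ∑ j, z j * star (z j) = ((‖rePart z‖ ^ 2 + ‖imPart z‖ ^ 2 : ℝ) : ℂ) := by
    rw [EuclideanSpace.norm_sq_eq, EuclideanSpace.norm_sq_eq, ← Finset.sum_add_distrib,
      Complex.ofReal_sum]
    apply Finset.sum_congr rfl
    intro j _
    simp [rePart, imPart, Complex.mul_conj, Complex.normSq_apply]
    ring
  rw [e2, finrank_euclideanSpace_fin, div_one, mul_left_comm, ← Complex.exp_add]
  congr 2
  push_cast
  rw [Complex.I_sq]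
  ring

theorem sum_mulVec {n : ℕ} (k : Matrix.unitaryGroup (Fin n) ℂ) (z w : Fin n → ℂ) :
    ∑ j, (k.1.mulVec z) j * star ((k.1.mulVec w) j) = ∑ j, z j * star (w j) := by
  change (k.1.mulVec z) ⬝ᵥ star (k.1.mulVec w) = z ⬝ᵥ star w
  rw [Matrix.star_mulVec, dotProduct_comm, ← Matrix.dotProduct_mulVec, Matrix.mulVec_mulVec,
    ← Matrix.star_eq_conjTranspose, Matrix.UnitaryGroup.star_mul_self, Matrix.one_mulVec,
    dotProduct_comm]

theorem cocycle_mulVec {n : ℕ} (k : Matrix.unitaryGroup (Fin n) ℂ) (z w : Fin n → ℂ) :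
    cocycle (k.1.mulVec z) (k.1.mulVec w) = cocycle z w := by
  rw [cocycle, sum_mulVec, cocycle]

theorem gram_mulVec {n : ℕ} (k : Matrix.unitaryGroup (Fin n) ℂ) (z w : Fin n → ℂ) :
    inner ℂ (schrodinger (k.1.mulVec z) (gauss n)) (schrodinger (k.1.mulVec w) (gauss n)) =
      inner ℂ (schrodinger z (gauss n)) (schrodinger w (gauss n)) := by
  rw [inner_schrodinger_left, inner_schrodinger_left, schrodinger_comp, schrodinger_comp,
    inner_smul_right, inner_smul_right, ← Matrix.mulVec_neg, cocycle_mulVec, ← Matrix.mulVec_add,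
    inner_gauss, inner_gauss, sum_mulVec]

/-- If all Fourier coefficients of an integrable function vanish, the function vanishes. -/
theorem ae_eq_zero_of_fourier {n : ℕ} {h : EuclideanSpace ℝ (Fin n) → ℂ} (hh : Integrable h)
    (h0 : ∀ x : EuclideanSpace ℝ (Fin n),
      ∫ ξ, Complex.exp ((inner ℝ x ξ : ℝ) * Complex.I) * h ξ = 0) : h =ᵐ[volume] 0 := by
  have hF : FourierTransform.fourier h = 0 := by
    funext w
    rw [Real.fourier_eq']
    rw [Pi.zero_apply, ← h0 (-(2 * Real.pi) • w)]
    congr 1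
    funext ξ
    rw [inner_smul_left, real_inner_comm, smul_eq_mul]
    simp
  refine ae_eq_zero_of_integral_contDiff_smul_eq_zero hh.locallyIntegrable fun g hg hc => ?_
  have hg' : ContDiff ℝ ((⊤ : ℕ∞) : WithTop ℕ∞) fun ξ => ((g ξ : ℝ) : ℂ) :=
    Complex.ofRealCLM.contDiff.comp hg
  have hc' : HasCompactSupport fun ξ => ((g ξ : ℝ) : ℂ) := hc.comp_left Complex.ofReal_zero
  let G : SchwartzMap (EuclideanSpace ℝ (Fin n)) ℂ := hc'.toSchwartzMap hg'
  let P := FourierTransformInv.fourierInv G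
  have hP : FourierTransform.fourier (P : EuclideanSpace ℝ (Fin n) → ℂ) = G := by
    rw [← SchwartzMap.fourier_coe]
    simp [P]
  have key := VectorFourier.integral_fourierIntegral_smul_eq_flip (L := innerₗ _)
    (μ := (volume : Measure (EuclideanSpace ℝ (Fin n)))) (ν := volume)
    Real.continuous_fourierChar continuous_inner hh P.integrable
  have a1 : VectorFourier.fourierIntegral Real.fourierChar volume (innerₗ _) h = 0 := hF
  have a2 : VectorFourier.fourierIntegral Real.fourierChar volume
      (innerₗ (EuclideanSpace ℝ (Fin n))).flip P = G := by
    rw [flip_innerₗ]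
    exact hP
  rw [a1, a2] at key
  simp only [Pi.zero_apply, zero_smul, integral_zero] at key
  rw [key]
  congr 1
  funext ξ
  simp [G, mul_comm]

theorem coherent_dense (n : ℕ) :
    (Submodule.span ℂ (Set.range fun z : Fin n → ℂ =>
      schrodinger z (gauss n))).topologicalClosure = ⊤ := by
  rw [Submodule.topologicalClosure_eq_top_iff, Submodule.eq_bot_iff]
  intro f hf
  have h1 : ∀ z : Fin n → ℂ, inner ℂ f (schrodinger z (gauss n)) = 0 := fun z =>
    Submodule.inner_left_of_mem_orthogonal (Submodule.subset_span (Set.mem_range_self z)) hf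
  have hg : gauss n =ᵐ[volume] _ := (memLp_gauss n).coeFn_toLp
  have h2 : (fun ξ => inner ℂ (f ξ) (gauss n ξ)) =ᵐ[volume] 0 := by
    refine ae_eq_zero_of_fourier (L2.integrable_inner f (gauss n)) fun x => ?_
    rw [← h1 fun j => (x j : ℂ), L2.inner_def]
    apply integral_congr_ae
    have e1 : rePart (fun j => (x j : ℂ)) = x := by ext j; simp [rePart]
    have e2 : imPart (fun j => (x j : ℂ)) = 0 := by ext j; simp [imPart]
    filter_upwards [coeFn_schrodinger (fun j => (x j : ℂ)) (gauss n)] with ξ a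
    rw [a, phase, e1, e2]
    simp [mul_assoc]
  apply Lp.ext
  filter_upwards [h2, hg, Lp.coeFn_zero ℂ 2 volume] with ξ a b c
  rw [c]
  rw [b, Pi.zero_apply, RCLike.inner_apply] at a
  rw [mul_eq_zero] at a
  rcases a with a | a
  · exact absurd a (by simp [Complex.ofReal_exp])
  · simpa using a

/-- A unitary representation of a topological group on a complex Hilbert space: it acts by
isometries (which are onto, since group elements are invertible) and is strongly continuous. -/
structure IsUnitaryRep {G E : Type*} [Group G] [TopologicalSpace G] [NormedAddCommGroup E]
    [InnerProductSpace ℂ E] (τ : Representation ℂ G E) : Prop where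
  norm_map : ∀ g v, ‖τ g v‖ = ‖v‖
  continuous_apply : ∀ v, Continuous fun g => τ g v

/-- `μ` is a metaplectic representation of `K = U(n)` on `L²(ℝⁿ)`: a unitary representation
by intertwining operators, `π(kz) = μ(k) π(z) μ(k)*`. By Schur's lemma this determines `μ` up to
a character of `K`. It exists: see `exists_isMetaplectic`. -/
structure IsMetaplectic {n : ℕ}
    (μ : Representation ℂ (Matrix.unitaryGroup (Fin n) ℂ) (L2 n)) : Prop where
  isUnitaryRep : IsUnitaryRep μ
  intertwines : ∀ (k : Matrix.unitaryGroup (Fin n) ℂ) (z : Fin n → ℂ),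
    schrodinger (k.1.mulVec z) = μ k ∘ₗ schrodinger z ∘ₗ μ k⁻¹

/-- The operator `ρ_σ(z, k) = π(z) μ(k) ⊗ σ(k)` on `L²(ℝⁿ) ⊗ H_σ`. As `H_σ` is
finite-dimensional, the algebraic tensor product with its canonical inner product is
already the Hilbert space tensor product. -/
def rho {n : ℕ} {H : Type*} [NormedAddCommGroup H] [InnerProductSpace ℂ H]
    (μ : Representation ℂ (Matrix.unitaryGroup (Fin n) ℂ) (L2 n))
    (σ : Representation ℂ (Matrix.unitaryGroup (Fin n) ℂ) H)
    (z : Fin n → ℂ) (k : Matrix.unitaryGroup (Fin n) ℂ) :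
    (L2 n ⊗[ℂ] H) →ₗ[ℂ] (L2 n ⊗[ℂ] H) :=
  TensorProduct.map (schrodinger z ∘ₗ μ k) (σ k)

/-- The Fourier–Wigner type transform `V_f^g(z, k) = ⟨ρ_σ(z, k) f, g⟩` on `ℂⁿ × K`, where
`⟨·, ·⟩` is linear in the first variable (`inner ℂ` is linear in the second). -/
def fourierWigner {n : ℕ} {H : Type*} [NormedAddCommGroup H] [InnerProductSpace ℂ H]
    (μ : Representation ℂ (Matrix.unitaryGroup (Fin n) ℂ) (L2 n))
    (σ : Representation ℂ (Matrix.unitaryGroup (Fin n) ℂ) H)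
    (f g : L2 n ⊗[ℂ] H) (p : (Fin n → ℂ) × Matrix.unitaryGroup (Fin n) ℂ) : ℂ :=
  inner ℂ g (rho μ σ p.1 p.2 f)

/-- A Gram matrix preserving map between two families of vectors, the first of which is total,
is induced by an isometry. -/
theorem exists_isometry_of_gram {ι E : Type*} [NormedAddCommGroup E] [InnerProductSpace ℂ E]
    [CompleteSpace E] (v w : ι → E)
    (hv : (Submodule.span ℂ (Set.range v)).topologicalClosure = ⊤)
    (h : ∀ i j, inner ℂ (w i) (w j) = inner ℂ (v i) (v j)) :
    ∃ T : E →ₗᵢ[ℂ] E, ∀ i, T (v i) = w i := by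
  let e := Finsupp.linearCombination ℂ v
  let f := Finsupp.linearCombination ℂ w
  have hn : ∀ x, ‖f x‖ = ‖e x‖ := by
    intro x
    have : inner ℂ (f x) (f x) = inner ℂ (e x) (e x) := by
      simp only [f, e, Finsupp.linearCombination_apply, Finsupp.sum_inner,
        Finsupp.inner_sum, inner_smul_left, inner_smul_right, h]
    rw [@norm_eq_sqrt_re_inner ℂ, @norm_eq_sqrt_re_inner ℂ _ _ _ _ (e x), this]
  have hd : DenseRange e := by
    rw [DenseRange, ← LinearMap.coe_range, Finsupp.range_linearCombination,
      Submodule.dense_iff_topologicalClosure_eq_top, hv]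
  have hle : ∀ x, ‖f x‖ ≤ 1 * ‖e x‖ := fun x => by rw [one_mul, hn]
  let T := f.extendOfNorm e
  have hT : ∀ x, T (e x) = f x := LinearMap.extendOfNorm_eq hd ⟨1, hle⟩
  refine ⟨⟨T.toLinearMap, fun x => ?_⟩, fun i => ?_⟩
  · refine hd.induction_on (p := fun x => ‖T x‖ = ‖x‖) x
      (isClosed_eq (by fun_prop) continuous_norm) fun a => ?_
    rw [hT, hn]
  · have := hT (Finsupp.single i 1)
    simpa [e, f] using this

theorem continuousMap_ext_coherent {n : ℕ} {F : Type*} [NormedAddCommGroup F]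
    [InnerProductSpace ℂ F] {S T : L2 n →L[ℂ] F}
    (h : ∀ z, S (schrodinger z (gauss n)) = T (schrodinger z (gauss n))) : S = T := by
  apply ContinuousLinearMap.ext_on (s := Set.range fun z : Fin n → ℂ => schrodinger z (gauss n))
  · rw [Submodule.dense_iff_topologicalClosure_eq_top, coherent_dense]
  · rintro _ ⟨z, rfl⟩
    exact h z

theorem continuous_coherent (n : ℕ) :
    Continuous fun z : Fin n → ℂ => schrodinger z (gauss n) := by
  rw [continuous_iff_continuousAt]
  intro w
  rw [ContinuousAt, tendsto_iff_norm_sub_tendsto_zero]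
  have key : ∀ z : Fin n → ℂ, ‖schrodinger z (gauss n) - schrodinger w (gauss n)‖ ^ 2 =
      2 * ‖gauss n‖ ^ 2 - 2 * (cocycle (-z) w * ((Real.pi : ℂ) ^ (n / 2 : ℂ) *
        Complex.exp (-(∑ j, (-z + w) j * star ((-z + w) j)) / 4))).re := by
    intro z
    rw [@norm_sub_sq ℂ, inner_schrodinger_left, schrodinger_comp, inner_smul_right, inner_gauss,
      norm_schrodinger, norm_schrodinger]
    simp only [RCLike.re_to_complex]
    ring
  have hc : Continuous fun z : Fin n → ℂ =>
      2 * ‖gauss n‖ ^ 2 - 2 * (cocycle (-z) w * ((Real.pi : ℂ) ^ (n / 2 : ℂ) *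
        Complex.exp (-(∑ j, (-z + w) j * star ((-z + w) j)) / 4))).re := by
    unfold cocycle
    simp only [Pi.add_apply, Pi.neg_apply]
    fun_prop
  have hc' : Continuous fun z : Fin n → ℂ =>
      ‖schrodinger z (gauss n) - schrodinger w (gauss n)‖ := by
    have : (fun z : Fin n → ℂ => ‖schrodinger z (gauss n) - schrodinger w (gauss n)‖) =
        fun z => √(‖schrodinger z (gauss n) - schrodinger w (gauss n)‖ ^ 2) := by
      funext z
      rw [Real.sqrt_sq (norm_nonneg _)]
    rw [this]
    simp only [key]
    exact hc.sqrt
  simpa using hc'.tendsto w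

/-- The metaplectic representation of `U(n)` exists. -/
theorem exists_isMetaplectic (n : ℕ) :
    ∃ μ : Representation ℂ (Matrix.unitaryGroup (Fin n) ℂ) (L2 n), IsMetaplectic μ := by
  have hex := fun k : Matrix.unitaryGroup (Fin n) ℂ =>
    exists_isometry_of_gram (fun z : Fin n → ℂ => schrodinger z (gauss n))
      (fun z => schrodinger (k.1.mulVec z) (gauss n)) (coherent_dense n) (gram_mulVec k)
  choose T hT using hex
  have h1 : T 1 = LinearIsometry.id := by
    have : (T 1).toContinuousLinearMap = ContinuousLinearMap.id ℂ _ :=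
      continuousMap_ext_coherent fun z => by simp [hT]
    ext1 x
    exact congrArg (fun S : L2 n →L[ℂ] L2 n => S x) this
  have hm : ∀ k l x, T (k * l) x = T k (T l x) := by
    intro k l x
    have : (T (k * l)).toContinuousLinearMap =
        (T k).toContinuousLinearMap ∘L (T l).toContinuousLinearMap :=
      continuousMap_ext_coherent fun z => by simp [hT, Matrix.mulVec_mulVec]
    exact congrArg (fun S : L2 n →L[ℂ] L2 n => S x) this
  have hi : ∀ k z x, schrodinger (k.1.mulVec z) (T k x) = T k (schrodinger z x) := by
    intro k z x
    let P : (Fin n → ℂ) → L2 n →ₗᵢ[ℂ] L2 n := fun z => ⟨schrodinger z, norm_schrodinger z⟩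
    have : (P (k.1.mulVec z)).toContinuousLinearMap ∘L (T k).toContinuousLinearMap =
        (T k).toContinuousLinearMap ∘L (P z).toContinuousLinearMap := by
      refine continuousMap_ext_coherent fun w => ?_
      change schrodinger (k.1.mulVec z) (T k (schrodinger w (gauss n))) =
        T k (schrodinger z (schrodinger w (gauss n)))
      rw [hT, schrodinger_comp, schrodinger_comp, map_smul, hT, cocycle_mulVec, Matrix.mulVec_add]
    exact congrArg (fun S : L2 n →L[ℂ] L2 n => S x) this
  let μ : Representation ℂ (Matrix.unitaryGroup (Fin n) ℂ) (L2 n) :=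
    { toFun := fun k => (T k).toLinearMap
      map_one' := by rw [h1]; rfl
      map_mul' := fun k l => LinearMap.ext (hm k l) }
  refine ⟨μ, ⟨fun k x => (T k).norm_map x, fun x => ?_⟩, fun k z => ?_⟩
  · change Continuous fun k => T k x
    have hx : x ∈ (Submodule.span ℂ (Set.range fun z : Fin n → ℂ =>
        schrodinger z (gauss n))).topologicalClosure := by rw [coherent_dense]; trivial
    have hs : ∀ y ∈ Submodule.span ℂ (Set.range fun z : Fin n → ℂ =>
        schrodinger z (gauss n)), Continuous fun k => T k y := by
      intro y hy
      induction hy using Submodule.span_induction with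
      | mem y h =>
        obtain ⟨z, rfl⟩ := h
        simp only [hT]
        exact (continuous_coherent n).comp
          (Continuous.matrix_mulVec continuous_subtype_val continuous_const)
      | zero => simp only [map_zero]; exact continuous_const
      | add a b _ _ ha hb => simp only [map_add]; exact ha.add hb
      | smul c a _ ha => simp only [map_smul]; exact ha.const_smul c
    refine continuous_of_uniform_approx_of_continuous fun u hu => ?_
    obtain ⟨ε, hε, hu⟩ := Metric.mem_uniformity_dist.1 hu
    obtain ⟨y, hy, hxy⟩ := Metric.mem_closure_iff.1 hx ε hε
    exact ⟨fun k => T k y, hs y hy, fun k => hu (by rwa [(T k).dist_map])⟩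
  · ext1 x
    change schrodinger (k.1.mulVec z) x = T k (schrodinger z (T k⁻¹ x))
    rw [← hi, ← hm, mul_inv_cancel, h1]
    rfl

end

end HeisenbergMotion
open HeisenbergMotion

open HeisenbergMotion

namespace HeisenbergMotion

/-! For fixed `k` the function `F(·, k)` is a matrix coefficient of finite rank: it is `z ↦ ∑ₐ ⟨π(z)
Φₐ, χₐ⟩` with finitely many terms and `χ` orthonormal (`exists_wigner_eq_inner_tmul`,
`exists_orthonormal_wigner_eq`). The claim thus reduces to an uncertainty principle of Benedicks
type on `ℂⁿ`, `eq_zero_of_wigner_eq_zero`, proved by counting dimensions.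

Let `W` be a space of families `Φ` whose transforms live on a set `T`. Members of an orthonormal
basis of `W` have transforms of squared `L²` norm `(2π)ⁿ` (`lintegral_wigner_sq`), while at each
point the squares of these transforms sum to at most the number `m` of terms, by Bessel
(`sum_norm_wigner_sq_le`). Integrating over `T` gives `dim W · (2π)ⁿ ≤ m |T|`.

If `Φ ≠ 0` has transform supported in `S`, then the families `π(jε eᵢ) Φ`, `j < N`, have transforms
supported in translates of `S` (`wigner_schrodinger`). They are linearly independent
(`linearIndependent_modulation`), and for small `ε` the union of the translates has measure at most
`|S| + 1`. So `N (2π)ⁿ ≤ m (|S| + 1)` for every `N`, which is absurd. -/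

/-! ### Plancherel's theorem for the Fourier integral. -/

theorem lintegral_enorm_sq_L2 {α : Type*} [MeasurableSpace α] {ν : Measure α} (f : Lp ℂ 2 ν) :
    ∫⁻ x, ‖f x‖ₑ ^ 2 ∂ν = ‖f‖ₑ ^ 2 := by
  rw [Lp.enorm_def, eLpNorm_eq_lintegral_rpow_enorm_toReal (by simp) (by simp)]
  simp only [ENNReal.toReal_ofNat, ENNReal.rpow_ofNat]
  rw [← ENNReal.rpow_natCast, ← ENNReal.rpow_mul]
  simp

open FourierTransform in
/-- On `L¹ ∩ L²` the Fourier transform of `L²` is given by the Fourier integral. -/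
theorem fourier_toLp_ae_eq {E : Type*} [NormedAddCommGroup E] [InnerProductSpace ℝ E]
    [FiniteDimensional ℝ E] [MeasurableSpace E] [BorelSpace E] {h : E → ℂ}
    (h1 : Integrable h) (h2 : MemLp h 2) :
    (𝓕 (h2.toLp h) : Lp ℂ 2 (volume : Measure E)) =ᵐ[volume] 𝓕 h := by
  have hcont : Continuous (𝓕 h : E → ℂ) :=
    VectorFourier.fourierIntegral_continuous Real.continuous_fourierChar
      (L := innerₗ E) continuous_inner h1
  refine ae_eq_of_integral_contDiff_smul_eq
    ((Lp.memLp _).locallyIntegrable (by norm_num)) hcont.locallyIntegrable fun g hg hc => ?_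
  have hg' : ContDiff ℝ ((⊤ : ℕ∞) : WithTop ℕ∞) fun ξ => ((g ξ : ℝ) : ℂ) :=
    Complex.ofRealCLM.contDiff.comp hg
  have hc' : HasCompactSupport fun ξ => ((g ξ : ℝ) : ℂ) := hc.comp_left Complex.ofReal_zero
  let G : SchwartzMap E ℂ := hc'.toSchwartzMap hg'
  -- The `L²` Fourier transform agrees with the distributional one, so testing against `G` moves the
  -- transform onto `G`; self-duality of the Fourier integral then moves it onto `h`.
  have key := congrArg (fun T : TemperedDistribution E ℂ => T G)
    (Lp.fourier_toTemperedDistribution_eq (h2.toLp h))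
  simp only [TemperedDistribution.fourier_apply, Lp.toTemperedDistribution_apply] at key
  have e1 : ∫ x, g x • (𝓕 (h2.toLp h) : Lp ℂ 2 (volume : Measure E)) x =
      ∫ x, G x • (𝓕 (h2.toLp h) : Lp ℂ 2 (volume : Measure E)) x := by
    congr 1
  have e2 : ∫ x, (𝓕 G) x • (h2.toLp h) x = ∫ x, (𝓕 G) x • h x := by
    apply integral_congr_ae
    filter_upwards [h2.coeFn_toLp] with x hx
    rw [hx]
  have e3 := VectorFourier.integral_fourierIntegral_smul_eq_flip (L := innerₗ E)
    (μ := (volume : Measure E)) (ν := volume)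
    Real.continuous_fourierChar continuous_inner G.integrable h1
  have a1 : VectorFourier.fourierIntegral Real.fourierChar volume (innerₗ E) G = 𝓕 G :=
    (SchwartzMap.fourier_coe G).symm
  have a2 : VectorFourier.fourierIntegral Real.fourierChar volume (innerₗ E).flip h = 𝓕 h := by
    rw [flip_innerₗ]
    rfl
  rw [a1, a2] at e3
  rw [e1, ← key, e2, e3]
  congr 1

open FourierTransform in
/-- Plancherel's theorem on `L¹ ∩ L²`. -/
theorem lintegral_fourier_sq {E : Type*} [NormedAddCommGroup E] [InnerProductSpace ℝ E]
    [FiniteDimensional ℝ E] [MeasurableSpace E] [BorelSpace E] {h : E → ℂ}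
    (h1 : Integrable h) (h2 : MemLp h 2) :
    ∫⁻ x, ‖𝓕 h x‖ₑ ^ 2 = ∫⁻ x, ‖h x‖ₑ ^ 2 := by
  calc ∫⁻ x, ‖𝓕 h x‖ₑ ^ 2
      = ∫⁻ x, ‖(𝓕 (h2.toLp h) : Lp ℂ 2 (volume : Measure E)) x‖ₑ ^ 2 :=
        lintegral_congr_ae <| by
          filter_upwards [fourier_toLp_ae_eq h1 h2] with x hx
          rw [hx]
    _ = ‖h2.toLp h‖ₑ ^ 2 := by
        rw [lintegral_enorm_sq_L2, ← ofReal_norm, Lp.norm_fourier_eq, ofReal_norm]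
    _ = ∫⁻ x, ‖h x‖ₑ ^ 2 := by
        rw [← lintegral_enorm_sq_L2]
        refine lintegral_congr_ae ?_
        filter_upwards [h2.coeFn_toLp] with x hx
        rw [hx]

/-! ### The Fourier–Wigner transform of finite families and its `L²` norm. -/

/-- The point `x + iy ∈ ℂⁿ` with real part `x` and imaginary part `y`. -/
def complexPoint {n : ℕ} (p : EuclideanSpace ℝ (Fin n) × EuclideanSpace ℝ (Fin n)) : Fin n → ℂ :=
  fun j => ⟨p.1 j, p.2 j⟩

@[simp]
theorem rePart_complexPoint {n : ℕ} (p : EuclideanSpace ℝ (Fin n) × EuclideanSpace ℝ (Fin n)) :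
    rePart (complexPoint p) = p.1 := rfl

@[simp]
theorem imPart_complexPoint {n : ℕ} (p : EuclideanSpace ℝ (Fin n) × EuclideanSpace ℝ (Fin n)) :
    imPart (complexPoint p) = p.2 := rfl

theorem measurePreserving_complexPoint (n : ℕ) :
    MeasurePreserving (complexPoint (n := n)) := by
  have h1 : MeasurePreserving (fun p : EuclideanSpace ℝ (Fin n) × EuclideanSpace ℝ (Fin n) =>
      ((p.1.ofLp, p.2.ofLp) : (Fin n → ℝ) × (Fin n → ℝ))) :=
    (PiLp.volume_preserving_ofLp (Fin n)).prod (PiLp.volume_preserving_ofLp (Fin n))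
  have h2 := (volume_measurePreserving_arrowProdEquivProdArrow ℝ ℝ (Fin n)).symm
  have h3 := volume_preserving_pi (ι := Fin n) (α' := fun _ => ℝ × ℝ) (β' := fun _ => ℂ)
    (f := fun _ => Complex.measurableEquivRealProd.symm)
    fun _ => Complex.volume_preserving_equiv_real_prod.symm
  exact h3.comp (h2.comp h1)

/-- The Fourier–Wigner transform `z ↦ ∑ₐ ⟨π(z) Φₐ, χₐ⟩` of two families in `L²(ℝⁿ)`. -/
noncomputable def wigner {n : ℕ} {ι : Type*} [Fintype ι] (χ Φ : ι → L2 n) (z : Fin n → ℂ) : ℂ :=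
  ∑ a, inner ℂ (χ a) (schrodinger z (Φ a))

/-- Up to a phase, `x ↦ wigner χ Φ (x + iy)` is the Fourier transform of this function. -/
noncomputable def wignerSlice {n : ℕ} {ι : Type*} [Fintype ι] (χ Φ : ι → L2 n)
    (y ξ : EuclideanSpace ℝ (Fin n)) : ℂ :=
  ∑ a, inner ℂ (χ a ξ) (Φ a (ξ + y))

section

variable {n : ℕ} {ι : Type*} [Fintype ι] (χ Φ : ι → L2 n)

theorem integrable_inner_translate (φ ψ : L2 n) (y : EuclideanSpace ℝ (Fin n)) :
    Integrable fun ξ => inner ℂ (φ ξ) (ψ (ξ + y)) := by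
  refine (L2.integrable_inner φ (schrodinger (complexPoint (0, y)) ψ)).congr ?_
  filter_upwards [coeFn_schrodinger (complexPoint (0, y)) ψ] with ξ h
  rw [h]
  simp [phase]

theorem integrable_wignerSlice (y : EuclideanSpace ℝ (Fin n)) :
    Integrable (wignerSlice χ Φ y) :=
  integrable_finsetSum _ fun a _ => integrable_inner_translate (χ a) (Φ a) y

theorem measurable_wignerSlice :
    Measurable fun p : EuclideanSpace ℝ (Fin n) × EuclideanSpace ℝ (Fin n) =>
      wignerSlice χ Φ p.1 p.2 := by
  unfold wignerSlice
  refine Finset.measurable_sum _ fun a _ => ?_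
  have h1 : Measurable (χ a) := (Lp.stronglyMeasurable (χ a)).measurable
  have h2 : Measurable (Φ a) := (Lp.stronglyMeasurable (Φ a)).measurable
  exact (h1.comp measurable_snd).inner (h2.comp (measurable_snd.add measurable_fst))

open FourierTransform in
-- The factor `exp (i x·y/2)` does not depend on `ξ` and has modulus one. What remains of the phase,
-- `exp (i x·ξ)`, is the kernel `exp (-2πi ξ·w)` at `w = -x/(2π)`.
theorem enorm_wigner_complexPoint (x y : EuclideanSpace ℝ (Fin n)) :
    ‖wigner χ Φ (complexPoint (x, y))‖ₑ =
      ‖𝓕 (wignerSlice χ Φ y) ((-(2 * Real.pi)⁻¹ : ℝ) • x)‖ₑ := by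
  have key : wigner χ Φ (complexPoint (x, y)) =
      Complex.exp (((1 / 2 * inner ℝ x y : ℝ) : ℂ) * Complex.I) *
        𝓕 (wignerSlice χ Φ y) ((-(2 * Real.pi)⁻¹ : ℝ) • x) := by
    rw [Real.fourier_eq', ← integral_const_mul]
    have h1 : wigner χ Φ (complexPoint (x, y)) = ∫ ξ, ∑ a,
        inner ℂ (χ a ξ) (schrodinger (complexPoint (x, y)) (Φ a) ξ) := by
      rw [integral_finsetSum _ fun a _ => L2.integrable_inner _ _]
      rfl
    rw [h1]
    apply integral_congr_ae
    have h2 : ∀ᵐ ξ, ∀ a, schrodinger (complexPoint (x, y)) (Φ a) ξ =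
        phase (complexPoint (x, y)) ξ * Φ a (ξ + y) :=
      ae_all_iff.2 fun a => coeFn_schrodinger _ _
    filter_upwards [h2] with ξ h
    have h3 : phase (complexPoint (x, y)) ξ =
        Complex.exp (((1 / 2 * inner ℝ x y : ℝ) : ℂ) * Complex.I) *
          Complex.exp (((-2 * Real.pi * inner ℝ ξ ((-(2 * Real.pi)⁻¹ : ℝ) • x) : ℝ) : ℂ) *
            Complex.I) := by
      rw [phase, ← Complex.exp_add, inner_smul_right, real_inner_comm, ← add_mul,
        ← Complex.ofReal_add]
      simp only [rePart_complexPoint, imPart_complexPoint]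
      congr 3
      field_simp
      ring
    simp only [h, h3, wignerSlice, smul_eq_mul, Finset.mul_sum]
    refine Finset.sum_congr rfl fun a _ => ?_
    rw [← smul_eq_mul (_ * _), inner_smul_right]
    ring
  rw [key, enorm_mul, ← ofReal_norm (Complex.exp _), Complex.norm_exp_ofReal_mul_I]
  simp

/-- By Tonelli and the substitution `η = ξ + y`, the variables separate. For fixed `η` the integral
over `ξ` is the squared norm of a combination of the `χₐ` with coefficients `conj (Φₐ η)`, which
Pythagoras evaluates. -/
theorem lintegral_wignerSlice_sq {χ : ι → L2 n} (hχ : Orthonormal ℂ χ) :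
    ∫⁻ y, ∫⁻ ξ, ‖wignerSlice χ Φ y ξ‖ₑ ^ 2 = ∑ a, ‖Φ a‖ₑ ^ 2 := by
  have hm := (measurable_wignerSlice χ Φ).enorm.pow_const 2
  rw [lintegral_lintegral_swap hm.aemeasurable]
  have e1 : ∀ ξ, ∫⁻ y, ‖wignerSlice χ Φ y ξ‖ₑ ^ 2 =
      ∫⁻ η, ‖∑ a, inner ℂ (χ a ξ) (Φ a η)‖ₑ ^ 2 := fun ξ =>
    lintegral_add_left_eq_self (fun η => ‖∑ a, inner ℂ (χ a ξ) (Φ a η)‖ₑ ^ 2) ξ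
  simp only [e1]
  have h1 : ∀ a, Measurable (χ a) := fun a => (Lp.stronglyMeasurable (χ a)).measurable
  have h2 : ∀ a, Measurable (Φ a) := fun a => (Lp.stronglyMeasurable (Φ a)).measurable
  rw [lintegral_lintegral_swap]
  swap
  · exact ((Finset.measurable_sum _ fun a _ => ((h1 a).comp measurable_fst).inner
      ((h2 a).comp measurable_snd)).enorm.pow_const 2).aemeasurable
  have e2 : ∀ η, ∫⁻ ξ, ‖∑ a, inner ℂ (χ a ξ) (Φ a η)‖ₑ ^ 2 = ∑ a, ‖Φ a η‖ₑ ^ 2 := by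
    intro η
    have e3 : ∫⁻ ξ, ‖∑ a, inner ℂ (χ a ξ) (Φ a η)‖ₑ ^ 2 =
        ‖∑ a, star (Φ a η) • χ a‖ₑ ^ 2 := by
      rw [← lintegral_enorm_sq_L2]
      apply lintegral_congr_ae
      have h3 : ∀ᵐ ξ, ∀ a, (star (Φ a η) • χ a : L2 n) ξ = star (Φ a η) * χ a ξ :=
        ae_all_iff.2 fun a => by
          filter_upwards [Lp.coeFn_smul (star (Φ a η)) (χ a)] with ξ h
          rw [h, Pi.smul_apply, smul_eq_mul]
      filter_upwards [h3, Lp.coeFn_finsetSum Finset.univ fun a => star (Φ a η) • χ a]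
        with ξ h3 h4
      have h5 : (∑ a, inner ℂ (χ a ξ) (Φ a η)) = star (∑ a, star (Φ a η) * χ a ξ) := by
        rw [star_sum]
        refine Finset.sum_congr rfl fun a _ => ?_
        simp [RCLike.inner_apply]
      rw [h4, Finset.sum_apply, ← ofReal_norm, ← ofReal_norm, h5, norm_star]
      simp only [h3]
    rw [e3, ← ofReal_norm, ← ENNReal.ofReal_pow (norm_nonneg _),
      @norm_sq_eq_re_inner ℂ, hχ.inner_sum]
    simp only [← ofReal_norm, ← ENNReal.ofReal_pow (norm_nonneg _)]
    rw [← ENNReal.ofReal_sum_of_nonneg fun _ _ => by positivity]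
    congr 1
    rw [map_sum]
    refine Finset.sum_congr rfl fun a _ => ?_
    rw [RCLike.conj_mul]
    simp [← Complex.ofReal_pow]
  simp only [e2]
  rw [lintegral_finsetSum _ fun a _ => (h2 a).enorm.pow_const 2]
  simp only [lintegral_enorm_sq_L2]

/-- Strong continuity holds on coherent states, since `π` moves them to coherent states up to a
continuous multiplier. It passes to the closure of their span because all `π(z)` are isometries, so
the approximation is uniform in `z`. -/
theorem continuous_schrodinger (φ : L2 n) : Continuous fun z => schrodinger z φ := by
  have hφ : φ ∈ (Submodule.span ℂ (Set.range fun z : Fin n → ℂ =>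
      schrodinger z (gauss n))).topologicalClosure := by rw [coherent_dense]; trivial
  have hs : ∀ ψ ∈ Submodule.span ℂ (Set.range fun z : Fin n → ℂ =>
      schrodinger z (gauss n)), Continuous fun z => schrodinger z ψ := by
    intro ψ hψ
    induction hψ using Submodule.span_induction with
    | mem ψ h =>
      obtain ⟨w, rfl⟩ := h
      simp only [schrodinger_comp]
      have hc : Continuous fun z => cocycle z w := by
        unfold cocycle
        fun_prop
      exact hc.smul ((continuous_coherent n).comp (continuous_add_const w))
    | zero => simp only [map_zero]; exact continuous_const
    | add a b _ _ ha hb => simp only [map_add]; exact ha.add hb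
    | smul c a _ ha => simp only [map_smul]; exact ha.const_smul c
  refine continuous_of_uniform_approx_of_continuous fun u hu => ?_
  obtain ⟨ε, hε, hu⟩ := Metric.mem_uniformity_dist.1 hu
  obtain ⟨ψ, hψ, hd⟩ := Metric.mem_closure_iff.1 hφ ε hε
  refine ⟨fun z => schrodinger z ψ, hs ψ hψ, fun z => hu ?_⟩
  rwa [dist_eq_norm, ← map_sub, norm_schrodinger, ← dist_eq_norm]

theorem continuous_wigner : Continuous (wigner χ Φ) :=
  continuous_finsetSum _ fun a _ => continuous_const.inner (continuous_schrodinger (Φ a))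

open FourierTransform in
/-- The isometry property of the Fourier–Wigner transform. -/
theorem lintegral_wigner_sq {χ : ι → L2 n} (hχ : Orthonormal ℂ χ) :
    ∫⁻ z, ‖wigner χ Φ z‖ₑ ^ 2 = ENNReal.ofReal ((2 * Real.pi) ^ n) * ∑ a, ‖Φ a‖ₑ ^ 2 := by
  have hm : Measurable fun z => ‖wigner χ Φ z‖ₑ ^ 2 :=
    (continuous_wigner χ Φ).measurable.enorm.pow_const 2
  have hmp := measurePreserving_complexPoint n
  rw [← hmp.lintegral_comp hm, Measure.volume_eq_prod,
    lintegral_prod_symm' (fun p => ‖wigner χ Φ (complexPoint p)‖ₑ ^ 2) (hm.comp hmp.measurable)]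
  have hslice := lintegral_wignerSlice_sq Φ hχ
  -- The double integral is finite, so almost every slice is in `L²` and Plancherel applies to it.
  have hfin : ∀ᵐ y, ∫⁻ ξ, ‖wignerSlice χ Φ y ξ‖ₑ ^ 2 < ⊤ := by
    refine ae_lt_top (((measurable_wignerSlice χ Φ).enorm.pow_const 2).lintegral_prod_right') ?_
    rw [hslice]
    simp
  rw [← hslice, ← lintegral_const_mul' _ _ ENNReal.ofReal_ne_top]
  apply lintegral_congr_ae
  filter_upwards [hfin] with y hy
  have h1 := integrable_wignerSlice χ Φ y
  have h2 : MemLp (wignerSlice χ Φ y) 2 := by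
    refine ⟨h1.1, ?_⟩
    rw [eLpNorm_eq_lintegral_rpow_enorm_toReal (by simp) (by simp)]
    simp only [ENNReal.toReal_ofNat, ENNReal.rpow_ofNat]
    exact ENNReal.rpow_lt_top_of_nonneg (by simp) hy.ne
  simp only [enorm_wigner_complexPoint]
  rw [← lintegral_fourier_sq h1 h2]
  have hr : (-(2 * Real.pi)⁻¹ : ℝ) ≠ 0 := by simp [Real.pi_ne_zero]
  have hF : Measurable fun w => ‖𝓕 (wignerSlice χ Φ y) w‖ₑ ^ 2 :=
    (VectorFourier.fourierIntegral_continuous Real.continuous_fourierChar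
      (L := innerₗ _) continuous_inner h1).measurable.enorm.pow_const 2
  -- The dilation `x ↦ -x/(2π)` of `ℝⁿ` is where the constant `(2π)ⁿ` comes from.
  rw [← lintegral_map (f := fun w => ‖𝓕 (wignerSlice χ Φ y) w‖ₑ ^ 2) hF
    (measurable_const_smul (-(2 * Real.pi)⁻¹ : ℝ)), Measure.map_addHaar_smul _ hr,
    lintegral_smul_measure, smul_eq_mul]
  congr 2
  rw [finrank_euclideanSpace_fin, neg_pow, abs_inv, abs_mul, abs_pow, abs_neg, abs_one, one_pow,
    one_mul, inv_pow, abs_inv, inv_inv, abs_of_pos (by positivity)]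

end

/-! ### Covariance and the dimension bound. -/

section

variable {n : ℕ} {ι : Type*} [Fintype ι]

/-- Covariance: since the multiplier never vanishes, acting by `π(w)` only translates the support of
the transform by `-w`. -/
theorem wigner_schrodinger (χ Φ : ι → L2 n) (z w : Fin n → ℂ) :
    wigner χ (fun a => schrodinger w (Φ a)) z = cocycle z w * wigner χ Φ (z + w) := by
  simp only [wigner, schrodinger_comp, inner_smul_right, Finset.mul_sum]

/-- Evaluation at `z` is pairing with a single vector of the Hilbert sum, which makes linearity in
`Φ` and Bessel's inequality available. -/
theorem wigner_eq_inner (χ : ι → L2 n) (Φ : PiLp 2 fun _ : ι => L2 n) (z : Fin n → ℂ) :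
    wigner χ Φ z = inner ℂ (WithLp.toLp 2 fun a => schrodinger (-z) (χ a)) Φ := by
  simp only [PiLp.inner_apply, inner_schrodinger_left, neg_neg, wigner]

/-- Bessel's inequality for the vector `(π(-z) χₐ)ₐ`, whose squared norm is the number of indices
for every `z`. -/
theorem sum_norm_wigner_sq_le {χ : ι → L2 n} (hχ : Orthonormal ℂ χ) {κ : Type*} [Fintype κ]
    {b : κ → PiLp 2 fun _ : ι => L2 n} (hb : Orthonormal ℂ b) (z : Fin n → ℂ) :
    ∑ j, ‖wigner χ (b j) z‖ ^ 2 ≤ Fintype.card ι := by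
  have h := hb.sum_inner_products_le (s := Finset.univ)
    (WithLp.toLp 2 fun a => schrodinger (-z) (χ a))
  rw [PiLp.norm_sq_eq_of_L2] at h
  simp only [norm_schrodinger, hχ.1, one_pow, Finset.sum_const, Finset.card_univ,
    nsmul_eq_mul, mul_one] at h
  refine le_trans (le_of_eq ?_) h
  refine Finset.sum_congr rfl fun j _ => ?_
  rw [wigner_eq_inner, norm_inner_symm]

/-- A space of families whose Fourier–Wigner transforms all vanish off a set of finite measure has
bounded dimension. -/
theorem finrank_mul_le_of_wigner_eq_zero {χ : ι → L2 n} (hχ : Orthonormal ℂ χ)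
    (W : Submodule ℂ (PiLp 2 fun _ : ι => L2 n)) [FiniteDimensional ℂ W] (T : Set (Fin n → ℂ))
    (hT : ∀ Φ ∈ W, ∀ z ∉ T, wigner χ Φ z = 0) :
    Module.finrank ℂ W * ENNReal.ofReal ((2 * Real.pi) ^ n) ≤ Fintype.card ι * volume T := by
  let b := stdOrthonormalBasis ℂ W
  have hb : Orthonormal ℂ fun j => (b j : PiLp 2 fun _ : ι => L2 n) :=
    b.orthonormal.comp_linearIsometry W.subtypeₗᵢ
  have hm : ∀ Φ : ι → L2 n, Measurable fun z => ‖wigner χ Φ z‖ₑ ^ 2 := fun Φ =>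
    (continuous_wigner χ Φ).measurable.enorm.pow_const 2
  -- Each basis vector carries the full mass `(2π)ⁿ` inside `T`. The measurable hull has the same
  -- measure, so `T` itself need not be measurable.
  have h1 : ∀ j, ENNReal.ofReal ((2 * Real.pi) ^ n) =
      ∫⁻ z in toMeasurable volume T, ‖wigner χ (b j).1 z‖ₑ ^ 2 := by
    intro j
    have h2 : ∑ a, ‖(b j).1 a‖ₑ ^ 2 = 1 := by
      simp only [← ofReal_norm, ← ENNReal.ofReal_pow (norm_nonneg _)]
      rw [← ENNReal.ofReal_sum_of_nonneg fun _ _ => by positivity, ← PiLp.norm_sq_eq_of_L2,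
        hb.1 j]
      simp
    rw [setLIntegral_eq_of_support_subset, lintegral_wigner_sq _ hχ, h2, mul_one]
    intro z hz
    by_contra h
    exact hz (by simp [hT _ (b j).2 z fun h' => h (subset_toMeasurable volume T h')])
  calc Module.finrank ℂ W * ENNReal.ofReal ((2 * Real.pi) ^ n)
      = ∑ j, ∫⁻ z in toMeasurable volume T, ‖wigner χ (b j).1 z‖ₑ ^ 2 := by
        simp only [← h1]
        simp
    _ = ∫⁻ z in toMeasurable volume T, ∑ j, ‖wigner χ (b j).1 z‖ₑ ^ 2 :=
        (lintegral_finsetSum _ fun j _ => hm _).symm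
    _ ≤ ∫⁻ z in toMeasurable volume T, Fintype.card ι := by
        refine lintegral_mono fun z => ?_
        have h := ENNReal.ofReal_le_ofReal (sum_norm_wigner_sq_le hχ hb z)
        rw [ENNReal.ofReal_sum_of_nonneg fun _ _ => by positivity, ENNReal.ofReal_natCast] at h
        simpa only [← ofReal_norm, ← ENNReal.ofReal_pow (norm_nonneg _)] using h
    _ = Fintype.card ι * volume T := by
        rw [setLIntegral_const, measure_toMeasurable]

end

/-! ### Linear independence of modulations. -/

theorem countable_setOf_cexp_eq {ε : ℝ} (hε : ε ≠ 0) (r : ℂ) :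
    {t : ℝ | Complex.exp (((ε * t : ℝ) : ℂ) * Complex.I) = r}.Countable := by
  by_cases h : ∃ s : ℝ, Complex.exp (((ε * s : ℝ) : ℂ) * Complex.I) = r
  · obtain ⟨s, hs⟩ := h
    refine (Set.countable_range fun m : ℤ => s + m * (2 * Real.pi) / ε).mono fun t ht => ?_
    obtain ⟨m, hm⟩ := Complex.exp_eq_exp_iff_exists_int.1 ((Set.mem_ofPred.1 ht).trans hs.symm)
    refine ⟨m, ?_⟩
    have h1 : ε * t = ε * s + m * (2 * Real.pi) := by
      have := congrArg Complex.im hm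
      simpa using this
    field_simp
    linarith
  · convert Set.countable_empty
    ext t
    simpa using fun ht => h ⟨t, ht⟩

/-- A nonzero trigonometric polynomial in one coordinate is nonzero almost everywhere. -/
theorem ae_eval_cexp_ne_zero {n : ℕ} (i : Fin n) {ε : ℝ} (hε : ε ≠ 0) {p : Polynomial ℂ}
    (hp : p ≠ 0) : ∀ᵐ ξ : EuclideanSpace ℝ (Fin n),
      p.eval (Complex.exp (((ε * ξ i : ℝ) : ℂ) * Complex.I)) ≠ 0 := by
  have h1 : {t : ℝ | p.eval (Complex.exp (((ε * t : ℝ) : ℂ) * Complex.I)) = 0}.Countable := by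
    refine ((p.roots.toFinset.countable_toSet).biUnion fun r _ =>
      countable_setOf_cexp_eq hε r).mono fun t ht => ?_
    simpa [hp] using ht
  have h2 : Measure.QuasiMeasurePreserving fun ξ : EuclideanSpace ℝ (Fin n) => ξ i :=
    (Measure.quasiMeasurePreserving_eval (fun _ : Fin n => (volume : Measure ℝ)) i).comp
      (PiLp.volume_preserving_ofLp (Fin n)).quasiMeasurePreserving
  exact h2.ae (p := fun t : ℝ => p.eval (Complex.exp (((ε * t : ℝ) : ℂ) * Complex.I)) ≠ 0)
    (by simpa [ae_iff] using h1.measure_zero volume)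

/-- At real points `π` acts by multiplication by characters, so a linear relation reads `p(exp (iε
ξᵢ)) φ(ξ) = 0` for a polynomial `p`. A nonzero `p` would force `φ = 0` almost everywhere. -/
theorem linearIndependent_modulation {n : ℕ} (i : Fin n) {ε : ℝ} (hε : ε ≠ 0) {φ : L2 n}
    (hφ : φ ≠ 0) (N : ℕ) : LinearIndependent ℂ fun j : Fin N =>
      schrodinger (Pi.single i (((j : ℝ) * ε : ℝ) : ℂ)) φ := by
  rw [Fintype.linearIndependent_iff]
  intro g hg
  let p : Polynomial ℂ := ∑ j : Fin N, Polynomial.monomial (j : ℕ) (g j)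
  have hp : p = 0 := by
    by_contra hp
    refine hφ (Lp.ext ?_)
    have h1 : ∀ᵐ ξ, ∀ j : Fin N,
        (g j • schrodinger (Pi.single i (((j : ℝ) * ε : ℝ) : ℂ)) φ : L2 n) ξ =
          g j * Complex.exp (((ε * ξ i : ℝ) : ℂ) * Complex.I) ^ (j : ℕ) * φ ξ := by
      refine ae_all_iff.2 fun j => ?_
      have e1 : imPart (Pi.single i (((j : ℝ) * ε : ℝ) : ℂ)) = 0 := by
        ext k
        by_cases hk : k = i
        · subst hk; simp [imPart]
        · simp [imPart, hk]
      have e2 : rePart (Pi.single i (((j : ℝ) * ε : ℝ) : ℂ)) =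
          EuclideanSpace.single i ((j : ℝ) * ε) := by
        ext k
        by_cases hk : k = i
        · subst hk; simp [rePart]
        · simp [rePart, hk]
      filter_upwards [Lp.coeFn_smul (g j) (schrodinger (Pi.single i (((j : ℝ) * ε : ℝ) : ℂ)) φ),
        coeFn_schrodinger (Pi.single i (((j : ℝ) * ε : ℝ) : ℂ)) φ] with ξ a b
      rw [a, Pi.smul_apply, b, smul_eq_mul, ← mul_assoc, phase, e1, e2, ← Complex.exp_nat_mul,
        EuclideanSpace.inner_single_left]
      simp
      ring_nf
      simp
    filter_upwards [h1, ae_eval_cexp_ne_zero i hε hp, Lp.coeFn_zero ℂ 2 volume,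
      Lp.coeFn_finsetSum Finset.univ fun j : Fin N =>
        g j • schrodinger (Pi.single i (((j : ℝ) * ε : ℝ) : ℂ)) φ] with ξ a b c d
    rw [hg, c, Finset.sum_apply] at d
    simp only [a, ← Finset.sum_mul, Pi.zero_apply] at d
    rw [c, Pi.zero_apply]
    refine (mul_eq_zero.1 d.symm).resolve_left ?_
    simpa [p, Polynomial.eval_finsetSum] using b
  intro j
  have := congrArg (fun q => Polynomial.coeff q (j : ℕ)) hp
  simpa [p, Polynomial.finsetSum_coeff, Polynomial.coeff_monomial, Fin.val_inj] using this

/-! ### Small translates and the uncertainty principle. -/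

/-- The union of finitely many translates of a set of finite measure has measure close to that of
the set, if the translations are small. -/
theorem exists_volume_iUnion_translate_le {n : ℕ} (i : Fin n) {S : Set (Fin n → ℂ)}
    (hS : volume S < ⊤) (N : ℕ) : ∃ ε : ℝ, ε ≠ 0 ∧
      volume (⋃ j : Fin N, {z : Fin n → ℂ | z + Pi.single i (((j : ℝ) * ε : ℝ) : ℂ) ∈ S}) ≤ volume S + 1 := by
  wlog hm : MeasurableSet S generalizing S
  · obtain ⟨ε, hε, h⟩ := this (S := toMeasurable volume S) (by rwa [measure_toMeasurable])
      (measurableSet_toMeasurable _ _)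
    rw [measure_toMeasurable] at h
    refine ⟨ε, hε, le_trans (measure_mono ?_) h⟩
    exact Set.iUnion_mono fun j z hz => subset_toMeasurable volume S hz
  let f : Fin N → ℝ → C(Fin n → ℂ, Fin n → ℂ) := fun j ε =>
    ⟨fun z => z + (Pi.single i (((j : ℝ) * ε : ℝ) : ℂ) : Fin n → ℂ), by fun_prop⟩
  have hf : ∀ j, Continuous (f j) := fun j => by
    refine ContinuousMap.continuous_of_continuous_uncurry _ ?_
    have h1 : Continuous fun p : ℝ × (Fin n → ℂ) =>
        (Pi.single i (((j : ℝ) * p.1 : ℝ) : ℂ) : Fin n → ℂ) :=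
      (continuous_single i).comp (by fun_prop)
    exact continuous_snd.add h1
  have h0 : ∀ j, f j 0 = ContinuousMap.id _ := fun j => by
    ext z
    simp [f]
  -- Translation is continuous in measure on sets of finite measure.
  have h1 : ∀ j, Filter.Tendsto (fun ε => volume (symmDiff (f j ε ⁻¹' S) S))
      (nhds 0) (nhds 0) := fun j => by
    refine tendsto_measure_symmDiff_preimage_nhds_zero (g := ContinuousMap.id _) (μ := volume)
      (ν := volume) ?_ ?_ ?_ hm.nullMeasurableSet hS.ne
    · rw [← h0 j]
      exact (hf j).tendsto 0
    · exact Filter.Eventually.of_forall fun ε => measurePreserving_add_right volume _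
    · exact MeasurePreserving.id _
  have h2 := tendsto_finsetSum Finset.univ fun j _ => h1 j
  rw [Finset.sum_const_zero] at h2
  -- Restricting to the punctured neighbourhood yields `ε ≠ 0`, without which the translates would
  -- coincide.
  have h3 := (h2.eventually (Iic_mem_nhds (zero_lt_one' ENNReal))).filter_mono
    (nhdsWithin_le_nhds (s := {0}ᶜ))
  obtain ⟨ε, hε, hε0⟩ := (h3.and self_mem_nhdsWithin).exists
  refine ⟨ε, hε0, ?_⟩
  have h4 : (⋃ j : Fin N, {z : Fin n → ℂ | z + Pi.single i (((j : ℝ) * ε : ℝ) : ℂ) ∈ S}) ⊆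
      S ∪ ⋃ j : Fin N, symmDiff (f j ε ⁻¹' S) S := by
    refine Set.iUnion_subset fun j z hz => ?_
    by_cases h : z ∈ S
    · exact Or.inl h
    · exact Or.inr (Set.mem_iUnion.2 ⟨j, Or.inl ⟨hz, h⟩⟩)
  refine (measure_mono h4).trans ((measure_union_le _ _).trans ?_)
  gcongr
  exact (measure_iUnion_fintype_le _ _).trans hε

/-- Benedicks' theorem for finite rank operators: if the Fourier–Wigner transform of a family,
taken against an orthonormal family, vanishes off a set of finite measure, the family is zero. -/
theorem eq_zero_of_wigner_eq_zero {n : ℕ} (i : Fin n) {ι : Type*} [Fintype ι] {χ : ι → L2 n}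
    (hχ : Orthonormal ℂ χ) (Φ : ι → L2 n) {S : Set (Fin n → ℂ)} (hS : volume S < ⊤)
    (h : ∀ z ∉ S, wigner χ Φ z = 0) : Φ = 0 := by
  by_contra hΦ
  obtain ⟨a, ha⟩ := Function.ne_iff.1 hΦ
  have hbound : ∀ N : ℕ, N * ENNReal.ofReal ((2 * Real.pi) ^ n) ≤
      Fintype.card ι * (volume S + 1) := by
    intro N
    obtain ⟨ε, hε, hT⟩ := exists_volume_iUnion_translate_le i hS N
    let v : Fin N → PiLp 2 fun _ : ι => L2 n := fun j =>
      WithLp.toLp 2 fun b => schrodinger (Pi.single i (((j : ℝ) * ε : ℝ) : ℂ)) (Φ b)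
    -- It suffices to look at one component `a` with `Φ a ≠ 0`.
    have hv : LinearIndependent ℂ v :=
      LinearIndependent.of_comp (PiLp.projₗ 2 (fun _ : ι => L2 n) a)
        (linearIndependent_modulation i hε ha N)
    have := FiniteDimensional.span_of_finite ℂ (Set.finite_range v)
    have hW := finrank_mul_le_of_wigner_eq_zero hχ (Submodule.span ℂ (Set.range v))
      (⋃ j : Fin N, {z : Fin n → ℂ | z + Pi.single i (((j : ℝ) * ε : ℝ) : ℂ) ∈ S}) ?_
    · rw [finrank_span_eq_card hv, Fintype.card_fin] at hW
      exact hW.trans (by gcongr)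
    · intro Ψ hΨ z hz
      rw [wigner_eq_inner]
      induction hΨ using Submodule.span_induction with
      | mem Ψ hΨ =>
        obtain ⟨j, rfl⟩ := hΨ
        rw [← wigner_eq_inner]
        refine (wigner_schrodinger χ Φ z _).trans ?_
        rw [h _ fun hz' => hz (Set.mem_iUnion.2 ⟨j, hz'⟩), mul_zero]
      | zero => rw [inner_zero_right]
      | add x y _ _ hx hy => rw [inner_add_right, hx, hy, add_zero]
      | smul c x _ hx => rw [inner_smul_right, hx, mul_zero]
  have hc : ENNReal.ofReal ((2 * Real.pi) ^ n) ≠ 0 := by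
    rw [Ne, ENNReal.ofReal_eq_zero, not_le]
    positivity
  have hR : (Fintype.card ι * (volume S + 1)) / ENNReal.ofReal ((2 * Real.pi) ^ n) ≠ ⊤ :=
    ENNReal.div_ne_top (ENNReal.mul_ne_top (by simp) (by simp [hS.ne])) hc
  obtain ⟨N, hN⟩ := ENNReal.exists_nat_gt hR
  rw [ENNReal.div_lt_iff (Or.inl hc) (Or.inl ENNReal.ofReal_ne_top)] at hN
  exact (hbound N).not_gt hN

/-! ### Reduction of the matrix coefficients to finite families. -/

/-- Both tensors are finite sums of pure ones, and `π(z)` does not touch the factor `H`: each pair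
of pure tensors contributes one term, with `⟨x, y⟩` absorbed as a scalar. -/
theorem exists_wigner_eq_inner_tmul {n : ℕ} {H : Type*} [NormedAddCommGroup H]
    [InnerProductSpace ℂ H] (f g : L2 n ⊗[ℂ] H) :
    ∃ (ι : Type) (_ : Fintype ι) (u v : ι → L2 n),
      ∀ z, inner ℂ g (TensorProduct.map (schrodinger z) LinearMap.id f) = wigner u v z := by
  induction g using TensorProduct.induction_on with
  | zero => exact ⟨Empty, inferInstance, Empty.elim, Empty.elim, fun z => by simp [wigner]⟩
  | add g₁ g₂ h₁ h₂ =>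
    obtain ⟨ι₁, _, u₁, v₁, h₁⟩ := h₁
    obtain ⟨ι₂, _, u₂, v₂, h₂⟩ := h₂
    exact ⟨ι₁ ⊕ ι₂, inferInstance, Sum.elim u₁ u₂, Sum.elim v₁ v₂, fun z => by
      rw [inner_add_left, h₁, h₂]
      simp [wigner]⟩
  | tmul ψ y =>
    induction f using TensorProduct.induction_on with
    | zero => exact ⟨Empty, inferInstance, Empty.elim, Empty.elim, fun z => by simp [wigner]⟩
    | add f₁ f₂ h₁ h₂ =>
      obtain ⟨ι₁, _, u₁, v₁, h₁⟩ := h₁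
      obtain ⟨ι₂, _, u₂, v₂, h₂⟩ := h₂
      exact ⟨ι₁ ⊕ ι₂, inferInstance, Sum.elim u₁ u₂, Sum.elim v₁ v₂, fun z => by
        rw [map_add, inner_add_right, h₁, h₂]
        simp [wigner]⟩
    | tmul φ x =>
      exact ⟨Unit, inferInstance, fun _ => ψ, fun _ => (inner ℂ y x : ℂ) • φ, fun z => by
        simp [wigner, TensorProduct.inner_tmul, inner_smul_right, mul_comm]⟩

/-- The first family in a Fourier–Wigner transform can be made orthonormal. -/
theorem exists_orthonormal_wigner_eq {n : ℕ} {ι : Type*} [Fintype ι] (u v : ι → L2 n) :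
    ∃ (m : ℕ) (χ Φ : Fin m → L2 n), Orthonormal ℂ χ ∧ wigner u v = wigner χ Φ := by
  let V := Submodule.span ℂ (Set.range u)
  have : FiniteDimensional ℂ V := FiniteDimensional.span_of_finite ℂ (Set.finite_range u)
  let b := stdOrthonormalBasis ℂ V
  have hu : ∀ a, u a = ∑ j, (inner ℂ (b j : L2 n) (u a) : ℂ) • (b j : L2 n) := fun a => by
    have h := congrArg Subtype.val
      (b.sum_repr' ⟨u a, Submodule.subset_span (Set.mem_range_self a)⟩)
    simpa using h.symm
  -- Expanding `u a` in the basis `b` puts the coefficients in the conjugate-linear slot; their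
  -- conjugates move onto `v a`.
  refine ⟨_, fun j => b j, fun j => ∑ a, star (inner ℂ (b j : L2 n) (u a) : ℂ) • v a,
    b.orthonormal.comp_linearIsometry V.subtypeₗᵢ, funext fun z => ?_⟩
  simp only [wigner, map_sum, map_smul, inner_sum, inner_smul_right]
  rw [Finset.sum_comm]
  refine Finset.sum_congr rfl fun a _ => ?_
  conv_lhs => rw [hu a, sum_inner]
  simp only [inner_smul_left]
  rfl

end HeisenbergMotion

theorem proposition3p4 {n : ℕ} (hn : 1 ≤ n)
    (μ : Representation ℂ (Matrix.unitaryGroup (Fin n) ℂ) (L2 n)) (hμ : IsMetaplectic μ)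
    {H : Type*} [NormedAddCommGroup H] [InnerProductSpace ℂ H] [FiniteDimensional ℂ H]
    (σ : Representation ℂ (Matrix.unitaryGroup (Fin n) ℂ) H)
    (hσ : IsUnitaryRep σ) (hirr : σ.IsIrreducible)
    (f₁ f₂ : L2 n ⊗[ℂ] H) (S : Set (Fin n → ℂ)) (hS : volume S < ⊤)
    (hF : Function.support (fourierWigner μ σ f₁ f₂) ⊆ S ×ˢ Set.univ) :
    fourierWigner μ σ f₁ f₂ = 0 := by
  funext ⟨z, k⟩
  -- With `k` fixed, `μ(k) ⊗ σ(k)` is absorbed into `f₁`, leaving only `π(z) ⊗ 1`.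
  obtain ⟨ι, _, u, v, huv⟩ :=
    exists_wigner_eq_inner_tmul (TensorProduct.map (μ k) (σ k) f₁) f₂
  obtain ⟨m, χ, Φ, hχ, hw⟩ := exists_orthonormal_wigner_eq u v
  have key : ∀ w, fourierWigner μ σ f₁ f₂ (w, k) = wigner χ Φ w := fun w => by
    rw [← hw, ← huv, ← LinearMap.comp_apply, ← TensorProduct.map_comp, LinearMap.id_comp]
    rfl
  -- Since `n ≥ 1`, there is a coordinate direction in which to translate; for `n = 0` all of `ℂⁿ`
  -- has finite measure and the conclusion can fail.
  have hΦ : Φ = 0 := eq_zero_of_wigner_eq_zero ⟨0, hn⟩ hχ Φ hS fun w hw' => by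
    rw [← key]
    by_contra h
    exact hw' (hF h).1
  rw [key, hΦ]
  simp [wigner]
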